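/- Let $(\Omega,\mathcal F,(\mathcal F_t)_{t=0}^T,P)$ be a finite filtered probability space with $P(\{\omega\})>0$ for all $\omega\in\Omega$ and $\mathcal F_0=\{\emptyset,\Omega\}$. Let $\Omega_t$ be the set of atoms of $\mathcal F_t$, and for $\omega\in\Omega_t$, $t<T$, let $\mathrm{succ}(\omega)=\{\bar\omega\in\Omega_{t+1}:\bar\omega\subseteq\omega\}$. For $t=0,\dots,T$ let $(\pi_t^{jk})_{1\le j,k\le d}$ be an $\mathcal F_t$-measurable bid-ask matrix, i.e. $\pi_t^{jk}>0$, $\pi_t^{jj}=1$, $\pi_t^{jl}\le\pi_t^{jk}\pi_t^{kl}$, and let $K_t$ be the convex cone spanned by the vectors $\pi_t^{jk}e^j-e^k$ and $e^j$, $1\le j,k\le d$. A self-financing portfolio process is an adapted $\mathbb R^d$-valued process $(V_t)_{t=0}^T$ with $V_t-V_{t-1}\in-K_t$ a.s. for all $t$, where $V_{-1}=0$; $A_T$ is the set of all values $V_T$ of such processes. Assume no arbitrage: the only $\mathbb R^d_+$-valued element of $A_T$ is $0$. Let $X$ be an $\mathcal F_T$-measurable $\mathbb R^d$-valued claim. Put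 $SHP_T(X)(\omega)=X(\omega)+K_T(\omega)$ for $\omega\in\Omega_T$ and $SHP_t(X)(\omega)=\bigcap_{\bar\omega\in\mathrm{succ}(\omega)}SHP_{t+1}(X)(\bar\omega)+K_t(\omega)$ for $t<T$, $\omega\in\Omega_t$. Fix a numéraire asset $i\in\{1,\dots,d\}$ and define functions $\mathbb R^d\to\mathbb R\cup\{-\infty\}$ as follows: for $\omega\in\Omega_T$ let $V_T^\omega(S)=X(\omega)^TS$; for $t<T$ and $\omega\in\Omega_t$ let $V_t^\omega=\mathrm{cap}\{\widetilde V_{t+1}^{\bar\omega}:\bar\omega\in\mathrm{succ}(\omega)\}$, the function whose hypograph is the closed convex hull of the union of the hypographs of the $\widetilde V_{t+1}^{\bar\omega}$; and for all $t\le T$ let $\widetilde V_t^\omega(S)=V_t^\omega(S)$ if $S^i=1$ and $S^k\le\pi_t^{jk}(\omega)S^j$ for all $j,k$, and $\widetilde V_t^\omega(S)=-\infty$ otherwise. Then $SHP_0(X)$ is the set $\{x_0\in\mathbb R^d: X\in x_0+A_T\}$ of all superhedging portfolios of $X$, and for all $t\in\{0,\dots,T\}$ and $\omega\in\Omega_t$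 the following hold. 1. $SHP_t(X)(\omega)$ is the set of all $x\in\mathbb R^d$ such that $S^Tx\ge\widetilde V_t^\omega(S)$ for every $S$ for which $(S,\widetilde V_t^\omega(S))$ is a vertex of $\mathrm{hypo}\,\widetilde V_t^\omega$. 2. $\mathrm{hypo}\,\widetilde V_t^\omega$ is the geometric dual (lower image) of $SHP_t(X)(\omega)$ in the following sense. There are a real matrix $B$ and a vector $b$ such that $\{x\in\mathbb R^d: Bx\ge b\}$ equals $\bigcap_{\bar\omega\in\mathrm{succ}(\omega)}SHP_{t+1}(X)(\bar\omega)$ if $t<T$ and $SHP_T(X)(\omega)$ if $t=T$, and such that $SHP_t(X)(\omega)$ is the upper image $\{x: Bx\ge b\}+K_t(\omega)$ of the problem to minimize $x$ with respect to the ordering cone $K_t(\omega)$ subject to $Bx\ge b$. For every pair $(B,b)$ such that $SHP_t(X)(\omega)=\{x: Bx\ge b\}+K_t(\omega)$, the set obtained from $\mathrm{hypo}\,\widetilde V_t^\omega\subseteq\mathbb R^d\times\mathbb R$ by omitting the coordinate $S^i$ (which is constantly $1$ there) equals the lower image $$\big\{\big((w_j)_{j\ne i},\,b^Tu\big): u\ge0,\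 B^Tu=w,\ w_i=1,\ w\in K_t(\omega)^+\big\}-\{0\}\times\mathbb R_+$$ of the geometric dual problem with parameter $c=e^i$, where $K_t(\omega)^+=\{w: w^Ty\ge0\text{ for all }y\in K_t(\omega)\}$. -/

import Mathlib

open MeasureTheory
open scoped Matrix Pointwise

namespace Superhedging

noncomputable section

/-! ### Market model -/

/-- Bid-ask matrices: `π j k` is the number of units of asset `j` that buy one unit of asset `k`. -/
structure IsBidAsk {d : ℕ} (π : Matrix (Fin d) (Fin d) ℝ) : Prop where
  pos : ∀ j k, 0 < π j k
  diag : ∀ j, π j j = 1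
  triangle : ∀ j k l, π j l ≤ π j k * π k l

/-- The solvency cone: the convex cone spanned by the vectors `π^{jk} e^j - e^k` and the unit
vectors `e^j`. -/
def solvencyCone {d : ℕ} (π : Matrix (Fin d) (Fin d) ℝ) : Set (Fin d → ℝ) :=
  (PointedCone.hull ℝ
    ({v | ∃ j k, v = π j k • (Pi.single j 1 : Fin d → ℝ) - Pi.single k 1} ∪
      {v | ∃ j, v = Pi.single j 1}) : PointedCone ℝ (Fin d → ℝ))

/-- The positive dual cone of a set. -/
def posDual {q : ℕ} (C : Set (Fin q → ℝ)) : Set (Fin q → ℝ) :=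
  {w | ∀ y ∈ C, 0 ≤ w ⬝ᵥ y}

section Market

variable {Ω : Type*} {m : MeasurableSpace Ω} {d : ℕ}

/-- `V` is (on times `0, …, T`) a self-financing portfolio process: it is adapted and
`V_t - V_{t-1} ∈ -K_t` almost surely for `t = 0, …, T`, where `V_{-1} = 0`. -/
structure IsSelfFinancing (P : Measure Ω) (ℱ : Filtration ℕ m) (T : ℕ)
    (π : ℕ → Ω → Matrix (Fin d) (Fin d) ℝ) (V : ℕ → Ω → Fin d → ℝ) : Prop where
  adapted : ∀ t ≤ T, Measurable[ℱ t] (V t)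
  initial : ∀ᵐ ω ∂P, V 0 ω ∈ -solvencyCone (π 0 ω)
  step : ∀ t < T, ∀ᵐ ω ∂P, V (t + 1) ω - V t ω ∈ -solvencyCone (π (t + 1) ω)

/-- `A_T`: the (almost sure classes of) time-`T` values of self-financing portfolio processes. -/
def attainable (P : Measure Ω) (ℱ : Filtration ℕ m) (T : ℕ)
    (π : ℕ → Ω → Matrix (Fin d) (Fin d) ℝ) : Set (Ω → Fin d → ℝ) :=
  {Y | ∃ V, IsSelfFinancing P ℱ T π V ∧ V T =ᵐ[P] Y}

/-- The no arbitrage property (NA): `A_T ∩ L⁰(ℱ_T, ℝ^d_+) = {0}`. -/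
def NoArbitrage (P : Measure Ω) (ℱ : Filtration ℕ m) (T : ℕ)
    (π : ℕ → Ω → Matrix (Fin d) (Fin d) ℝ) : Prop :=
  ∀ Y ∈ attainable P ℱ T π, (∀ᵐ ω ∂P, ∀ j, 0 ≤ Y ω j) → Y =ᵐ[P] 0

/-- The initial portfolios `x₀ ∈ ℝ^d` that allow to superhedge `X`: `X ∈ x₀ + A_T`. -/
def initialSuperhedging (P : Measure Ω) (ℱ : Filtration ℕ m) (T : ℕ)
    (π : ℕ → Ω → Matrix (Fin d) (Fin d) ℝ) (X : Ω → Fin d → ℝ) : Set (Fin d → ℝ) :=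
  {x₀ | (fun ω => X ω - x₀) ∈ attainable P ℱ T π}

/-- The atom of `ℱ_t` that contains `ω`, i.e. the node of the event tree at time `t` through `ω`.
Nodes are represented by their points; the atoms of `ℱ_{t+1}` through the points of
`node ℱ t ω` are exactly the successors of that node. -/
def node (ℱ : Filtration ℕ m) (t : ℕ) (ω : Ω) : Set Ω := @measurableAtom Ω (ℱ t) ω

/-- `SHP_t(X)(ω)`, the superhedging portfolios at time `t ≤ T` at the node through `ω`:
`SHP_T(X)(ω) = X(ω) + K_T(ω)`, and
`SHP_t(X)(ω) = (⋂_{ω' ∈ succ ω} SHP_{t+1}(X)(ω')) + K_t(ω)` for `t < T`. -/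
def SHP (ℱ : Filtration ℕ m) (T : ℕ) (π : ℕ → Ω → Matrix (Fin d) (Fin d) ℝ)
    (X : Ω → Fin d → ℝ) (t : ℕ) (ω : Ω) : Set (Fin d → ℝ) :=
  if _h : t < T then
    (⋂ ω' ∈ node ℱ t ω, SHP ℱ T π X (t + 1) ω') + solvencyCone (π t ω)
  else {X ω} + solvencyCone (π t ω)
termination_by T - t

end Market

/-! ### The scalar algorithm -/

/-- The hypograph of an extended real-valued function, a subset of `ℝ^d × ℝ`. -/
def hypo {d : ℕ} (f : (Fin d → ℝ) → EReal) : Set ((Fin d → ℝ) × ℝ) :=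
  {p | (p.2 : EReal) ≤ f p.1}

/-- The concave cap of a family of functions: the function whose hypograph is the closed convex
hull of the union of the hypographs of the members (see `hypo_cap`). -/
def cap {d : ℕ} (F : Set ((Fin d → ℝ) → EReal)) (S : Fin d → ℝ) : EReal :=
  sSup ((fun r : ℝ => (r : EReal)) '' {r | (S, r) ∈ closure (convexHull ℝ (⋃ f ∈ F, hypo f))})

/-- The defining property of the concave cap. -/
theorem hypo_cap {d : ℕ} (F : Set ((Fin d → ℝ) → EReal)) :
    hypo (cap F) = closure (convexHull ℝ (⋃ f ∈ F, hypo f)) := by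
  set U : Set ((Fin d → ℝ) × ℝ) := ⋃ f ∈ F, hypo f with hU
  have down : ∀ s : ℝ, 0 ≤ s → ∀ p ∈ closure (convexHull ℝ U),
      p + ((0 : Fin d → ℝ), -s) ∈ closure (convexHull ℝ U) := by
    intro s hs p hp
    have h1 : Set.MapsTo (fun p : (Fin d → ℝ) × ℝ => p + ((0 : Fin d → ℝ), -s))
        (convexHull ℝ U) (convexHull ℝ U) := by
      have hc : Convex ℝ
          ((fun p : (Fin d → ℝ) × ℝ => p + ((0 : Fin d → ℝ), -s)) ⁻¹' convexHull ℝ U) :=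
        (convex_convexHull ℝ U).translate_preimage_left _
      refine convexHull_min ?_ hc
      intro q hq
      refine subset_convexHull ℝ U ?_
      simp only [hU, Set.mem_iUnion, exists_prop] at hq ⊢
      obtain ⟨f, hf, hq⟩ := hq
      refine ⟨f, hf, ?_⟩
      change (((q.2 + -s : ℝ)) : EReal) ≤ f (q.1 + 0)
      rw [add_zero]
      refine le_trans ?_ (show (q.2 : EReal) ≤ f q.1 from hq)
      exact_mod_cast (by linarith : q.2 + -s ≤ q.2)
    exact h1.closure (by fun_prop) hp
  ext ⟨S, r⟩
  constructor
  · intro h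
    have hlt : ∀ ε : ℝ, 0 < ε → (S, r - ε) ∈ closure (convexHull ℝ U) := by
      intro ε hε
      have h1 : ((r - ε : ℝ) : EReal) < cap F S :=
        lt_of_lt_of_le (by exact_mod_cast (by linarith : r - ε < r)) h
      obtain ⟨_, ⟨r', hr', rfl⟩, h2⟩ := lt_sSup_iff.1 h1
      have h3 : r - ε < r' := by exact EReal.coe_lt_coe_iff.1 h2
      have h4 := down (r' - (r - ε)) (by linarith) (S, r') hr'
      simpa using h4
    have hlim : Filter.Tendsto (fun ε : ℝ => (S, r - ε)) (nhdsWithin 0 (Set.Ioi 0))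
        (nhds (S, r)) := by
      have : Continuous (fun ε : ℝ => (S, r - ε)) := by fun_prop
      have h5 := this.tendsto 0
      simp only [sub_zero] at h5
      exact h5.mono_left nhdsWithin_le_nhds
    exact isClosed_closure.mem_of_tendsto hlim
      (Filter.eventually_of_mem self_mem_nhdsWithin fun ε hε => hlt ε hε)
  · intro h
    change (r : EReal) ≤ cap F S
    exact le_sSup (Set.mem_image_of_mem (fun r : ℝ => (r : EReal)) h)

/-- The price vectors in units of the numeraire `i` that are consistent with the bid-ask matrix:
`S^i = 1` and `S^k ≤ π^{jk} S^j` for all `j, k`. -/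
def priceSet {d : ℕ} (π : Matrix (Fin d) (Fin d) ℝ) (i : Fin d) : Set (Fin d → ℝ) :=
  {S | S i = 1 ∧ ∀ j k, S k ≤ π j k * S j}

open scoped Classical in
/-- The functions `Ṽ_t^ω` of the scalar algorithm with numeraire `i`. For `t < T`,
`V_t^ω = cap {Ṽ_{t+1}^{ω'} : ω' ∈ succ ω}`, while `V_T^ω(S) = X(ω)ᵀ S`; then `Ṽ_t^ω` equals `V_t^ω`
on the set of consistent prices and `-∞` elsewhere. -/
def scalarV {Ω : Type*} {m : MeasurableSpace Ω} {d : ℕ} (ℱ : Filtration ℕ m) (T : ℕ)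
    (π : ℕ → Ω → Matrix (Fin d) (Fin d) ℝ) (X : Ω → Fin d → ℝ) (i : Fin d)
    (t : ℕ) (ω : Ω) (S : Fin d → ℝ) : EReal :=
  if S ∈ priceSet (π t ω) i then
    if _h : t < T then
      cap {f | ∃ ω' ∈ node ℱ t ω, f = fun S' => scalarV ℱ T π X i (t + 1) ω' S'} S
    else ((X ω ⬝ᵥ S : ℝ) : EReal)
  else ⊥
termination_by T - t

/-! ### Linear vector optimization and geometric duality

Minimize `A x` with respect to the ordering cone `C` subject to `B x ≥ b`. The parameter `c` is an
interior point of `C`, and `i` is the distinguished coordinate of the image space `ℝ^q` with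
`c_i = 1` (the last one, if the coordinates are numbered accordingly). -/

/-- The feasible set `{x | B x ≥ b}`. -/
def feasible {r d : ℕ} (B : Matrix (Fin r) (Fin d) ℝ) (b : Fin r → ℝ) : Set (Fin d → ℝ) :=
  {x | b ≤ B *ᵥ x}

/-- The upper image `A[{x | B x ≥ b}] + C` of the primal problem. -/
def upperImage {r d q : ℕ} (A : Matrix (Fin q) (Fin d) ℝ) (B : Matrix (Fin r) (Fin d) ℝ)
    (b : Fin r → ℝ) (C : Set (Fin q → ℝ)) : Set (Fin q → ℝ) :=
  (fun x => A *ᵥ x) '' feasible B b + C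

/-- The feasible set of the geometric dual problem:
`u ≥ 0`, `Bᵀ u = Aᵀ w`, `cᵀ w = 1`, `w ∈ C⁺`. -/
def dualFeasible {r d q : ℕ} (A : Matrix (Fin q) (Fin d) ℝ) (B : Matrix (Fin r) (Fin d) ℝ)
    (C : Set (Fin q → ℝ)) (c : Fin q → ℝ) : Set ((Fin r → ℝ) × (Fin q → ℝ)) :=
  {p | 0 ≤ p.1 ∧ Bᵀ *ᵥ p.1 = Aᵀ *ᵥ p.2 ∧ c ⬝ᵥ p.2 = 1 ∧ p.2 ∈ posDual C}

/-- Omit the `i`-th coordinate of the first component. -/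
def omitCoord {q : ℕ} (i : Fin q) (p : (Fin q → ℝ) × ℝ) : ({j : Fin q // j ≠ i} → ℝ) × ℝ :=
  (fun j => p.1 j, p.2)

/-- The lower image `D*[T] - ℝ₊ (0, …, 0, 1)ᵀ` of the geometric dual problem, whose objective is
`D*(u, w) = ((w_j)_{j ≠ i}, bᵀ u)`. -/
def lowerImage {r d q : ℕ} (A : Matrix (Fin q) (Fin d) ℝ) (B : Matrix (Fin r) (Fin d) ℝ)
    (b : Fin r → ℝ) (C : Set (Fin q → ℝ)) (c : Fin q → ℝ) (i : Fin q) :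
    Set (({j : Fin q // j ≠ i} → ℝ) × ℝ) :=
  (fun p => omitCoord i (p.2, b ⬝ᵥ p.1)) '' dualFeasible A B C c -
    {z | z.1 = 0 ∧ 0 ≤ z.2}

end

end Superhedging

/-! The proof rests on one identity, `hypo_scalarV`: the function computed at a node is the support
function `S ↦ inf {Sᵀx | x ∈ SHP_t}`, restricted to consistent prices. It follows by backward
induction, since each operation on sets of portfolios is dual to an operation on functions. Adding
the cone `K_t` leaves the infimum unchanged for prices in the positive dual cone, and the consistent
prices are the slice `S^i = 1` of that cone. Intersecting over the successors corresponds to the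
concave cap (`mem_closure_convexHull_supportHypo_iff`).

These dualities need closed sets. All sets in the recursion are polyhedra, because Fourier–Motzkin
elimination shows that a polyhedron plus a finitely generated cone is again one
(`IsPolyhedral.add_hull`). They are also nonempty, since solvent sets have common upper bounds.

Given the identity, claim 1 is the bipolar theorem (`IsSolvent.mem_iff`) together with the fact that
a linear inequality need only be tested at vertices: the hypograph lies over a compact set of prices
and is bounded above. Claim 2 is linear programming duality (`exists_dual_certificate`): `v ≤ Sᵀx`
on `{Bx ≥ b}` has a certificate `u ≥ 0` with `Bᵀu = S` and `v ≤ bᵀu`.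

The description of `SHP_0` is dynamic programming. A self-financing process stays in the
continuation sets by backward induction; conversely, trading into these sets node by node gives an
adapted hedge. -/

namespace Superhedging

/-! ### Polyhedra -/

section Polyhedra

variable {E : Type*} [AddCommGroup E] [Module ℝ E] [TopologicalSpace E]

/-- A polyhedron: the solution set of a finite system of continuous affine inequalities. -/
def IsPolyhedral (P : Set E) : Prop :=
  ∃ F : Set (StrongDual ℝ E × ℝ), F.Finite ∧ P = {x | ∀ p ∈ F, p.2 ≤ p.1 x}

theorem IsPolyhedral.isClosed {P : Set E} (h : IsPolyhedral P) : IsClosed P := by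
  obtain ⟨F, -, rfl⟩ := h
  simp only [Set.ofPred_forall]
  exact isClosed_biInter fun p _ => isClosed_le continuous_const p.1.continuous

theorem IsPolyhedral.convex {P : Set E} (h : IsPolyhedral P) : Convex ℝ P := by
  obtain ⟨F, -, rfl⟩ := h
  simp only [Set.ofPred_forall]
  exact convex_iInter₂ fun p _ => convex_halfSpace_ge p.1.toLinearMap.isLinear p.2

theorem IsPolyhedral.iInter {ι : Sort*} [Finite ι] {P : ι → Set E}
    (h : ∀ a, IsPolyhedral (P a)) : IsPolyhedral (⋂ a, P a) := by
  choose F hF hP using h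
  refine ⟨⋃ a, F a, Set.finite_iUnion hF, ?_⟩
  ext x
  simp only [hP, Set.mem_iInter, Set.mem_iUnion, Set.mem_ofPred_eq]
  exact ⟨fun h p ⟨a, ha⟩ => h a p ha, fun h a p ha => h p ⟨a, ha⟩⟩

theorem IsPolyhedral.inter {P Q : Set E} (hP : IsPolyhedral P) (hQ : IsPolyhedral Q) :
    IsPolyhedral (P ∩ Q) := by
  rw [Set.inter_eq_iInter]
  exact .iInter fun b => by cases b <;> assumption

theorem isPolyhedral_setOf_eq (f : StrongDual ℝ E) (c : ℝ) : IsPolyhedral {x | f x = c} := by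
  refine ⟨{(f, c), (-f, -c)}, by simp, ?_⟩
  ext x
  simp [le_antisymm_iff, and_comm]

theorem isPolyhedral_singleton_pi {ι : Type*} [Finite ι] (x : ι → ℝ) :
    IsPolyhedral ({x} : Set (ι → ℝ)) := by
  have : ({x} : Set (ι → ℝ)) =
      ⋂ j, {y | (ContinuousLinearMap.proj j : StrongDual ℝ (ι → ℝ)) y = x j} := by
    ext y
    simp [funext_iff]
  rw [this]
  exact .iInter fun j => isPolyhedral_setOf_eq _ _

theorem IsPolyhedral.prod {E' : Type*} [AddCommGroup E'] [Module ℝ E'] [TopologicalSpace E']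
    {P : Set E} {Q : Set E'} (hP : IsPolyhedral P) (hQ : IsPolyhedral Q) :
    IsPolyhedral (P ×ˢ Q) := by
  obtain ⟨F, hF, rfl⟩ := hP
  obtain ⟨G, hG, rfl⟩ := hQ
  have h1 : IsPolyhedral {z : E × E' | ∀ p ∈ F, p.2 ≤ p.1 z.1} :=
    ⟨(fun p => (p.1.comp (ContinuousLinearMap.fst ℝ E E'), p.2)) '' F, hF.image _, by
      ext; simp only [Set.mem_ofPred_eq, Set.forall_mem_image]; rfl⟩
  have h2 : IsPolyhedral {z : E × E' | ∀ p ∈ G, p.2 ≤ p.1 z.2} :=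
    ⟨(fun p => (p.1.comp (ContinuousLinearMap.snd ℝ E E'), p.2)) '' G, hG.image _, by
      ext; simp only [Set.mem_ofPred_eq, Set.forall_mem_image]; rfl⟩
  exact h1.inter h2

/-- Fourier–Motzkin elimination: the sum of a polyhedron and a ray is a polyhedron. -/
theorem IsPolyhedral.add_ray [IsTopologicalAddGroup E] [ContinuousConstSMul ℝ E]
    {P : Set E} (h : IsPolyhedral P) (v : E) :
    IsPolyhedral {x | ∃ c : ℝ, 0 ≤ c ∧ x - c • v ∈ P} := by
  obtain ⟨F, hF, rfl⟩ := h
  -- For `x - c • v`, an inequality with `p.1 v > 0` bounds `c` from above and one with `p.1 v < 0`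
  -- from below. Eliminating `c` pairs each upper bound with each lower bound, and the constraint `0
  -- ≤ c` keeps the inequalities with `p.1 v ≥ 0` as they are.
  refine ⟨{p ∈ F | 0 ≤ p.1 v} ∪
    (fun pq : (StrongDual ℝ E × ℝ) × (StrongDual ℝ E × ℝ) =>
      ((pq.1.1 v) • pq.2.1 - (pq.2.1 v) • pq.1.1,
        pq.1.1 v * pq.2.2 - pq.2.1 v * pq.1.2)) '' ({p ∈ F | 0 < p.1 v} ×ˢ {q ∈ F | q.1 v < 0}),
    ?_, ?_⟩
  · exact (hF.subset (Set.sep_subset _ _)).union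
      (((hF.subset (Set.sep_subset _ _)).prod (hF.subset (Set.sep_subset _ _))).image _)
  ext x
  simp only [Set.mem_ofPred_eq, map_sub, map_smul, smul_eq_mul]
  constructor
  · rintro ⟨c, hc, hx⟩ p (⟨hp, hpv⟩ | ⟨⟨p, q⟩, ⟨⟨hp, hpv⟩, hq, hqv⟩, rfl⟩)
    · have := hx p hp
      nlinarith [mul_nonneg hc hpv]
    · simp only [sub_apply, smul_apply, smul_eq_mul]
      nlinarith [mul_nonneg hpv.le (sub_nonneg.2 (hx q hq)),
        mul_nonneg (neg_nonneg.2 hqv.le) (sub_nonneg.2 (hx p hp))]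
  · intro hx
    have h0 : ∀ p ∈ F, 0 ≤ p.1 v → p.2 ≤ p.1 x := fun p hp hpv => hx p (Or.inl ⟨hp, hpv⟩)
    have hpair : ∀ p ∈ F, 0 < p.1 v → ∀ q ∈ F, q.1 v < 0 →
        p.1 v * q.2 - q.1 v * p.2 ≤ p.1 v * q.1 x - q.1 v * p.1 x := fun p hp hpv q hq hqv => by
      simpa using hx _ (Or.inr ⟨(p, q), ⟨⟨hp, hpv⟩, hq, hqv⟩, rfl⟩)
    -- Take the largest lower bound, counting `0` among them; the maximum exists because `F` is
    -- finite.
    obtain ⟨c, hc, hcq, hcp⟩ : ∃ c : ℝ, 0 ≤ c ∧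
        (∀ q ∈ F, q.1 v < 0 → (q.1 x - q.2) / q.1 v ≤ c) ∧
        ∀ p ∈ F, 0 < p.1 v → c * p.1 v ≤ p.1 x - p.2 := by
      rcases Set.eq_empty_or_nonempty {q ∈ F | q.1 v < 0} with hN | hN
      · refine ⟨0, le_rfl, fun q hq hqv => ?_, fun p hp hpv => ?_⟩
        · exact absurd (show q ∈ {q ∈ F | q.1 v < 0} from ⟨hq, hqv⟩) (hN ▸ Set.notMem_empty q)
        · linarith [h0 p hp hpv.le]
      · obtain ⟨q₀, ⟨hq₀, hq₀v⟩, hmax⟩ := Set.exists_max_image _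
          (fun q : StrongDual ℝ E × ℝ => (q.1 x - q.2) / q.1 v)
          (hF.subset (Set.sep_subset _ _)) hN
        refine ⟨max 0 ((q₀.1 x - q₀.2) / q₀.1 v), le_max_left _ _,
          fun q hq hqv => (hmax q ⟨hq, hqv⟩).trans (le_max_right _ _), fun p hp hpv => ?_⟩
        rcases max_cases 0 ((q₀.1 x - q₀.2) / q₀.1 v) with ⟨h, -⟩ | ⟨h, -⟩ <;> rw [h]
        · linarith [h0 p hp hpv.le]
        · rw [div_mul_eq_mul_div, div_le_iff_of_neg hq₀v]
          linarith [hpair p hp hpv q₀ hq₀ hq₀v]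
    refine ⟨c, hc, fun p hp => ?_⟩
    rcases lt_trichotomy (p.1 v) 0 with hpv | hpv | hpv
    · have := hcq p hp hpv
      rw [div_le_iff_of_neg hpv] at this
      linarith
    · rw [hpv]
      linarith [h0 p hp hpv.ge]
    · linarith [hcp p hp hpv]

/-- The sum of a polyhedron and a finitely generated cone is a polyhedron. -/
theorem IsPolyhedral.add_hull [IsTopologicalAddGroup E] [ContinuousConstSMul ℝ E]
    {s : Set E} (hs : s.Finite) : ∀ {P : Set E}, IsPolyhedral P →
      IsPolyhedral (P + (PointedCone.hull ℝ s : Set E)) := by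
  induction s, hs using Set.Finite.induction_on with
  | empty =>
    intro P hP
    simpa using hP
  | @insert v s _ _ ih =>
    intro P hP
    have h := ih (hP.add_ray v)
    convert h using 1
    rw [PointedCone.hull, Submodule.span_insert, Submodule.coe_sup, ← add_assoc]
    congr 1
    ext x
    simp only [Set.mem_add, SetLike.mem_coe, Submodule.mem_span_singleton, Set.mem_ofPred_eq]
    constructor
    · rintro ⟨y, hy, _, ⟨c, rfl⟩, rfl⟩
      refine ⟨c, c.2, ?_⟩
      rw [show y + c • v - (c : ℝ) • v = y from add_sub_cancel_right _ _]
      exact hy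
    · rintro ⟨c, hc, hx⟩
      exact ⟨_, hx, _, ⟨⟨c, hc⟩, rfl⟩, sub_add_cancel _ _⟩

end Polyhedra

/-! ### Linear functionals in coordinates and linear programming duality -/

theorem StrongDual.exists_eq_dotProduct {ι : Type*} [Fintype ι] (f : StrongDual ℝ (ι → ℝ)) :
    ∃ y : ι → ℝ, ∀ x, f x = y ⬝ᵥ x := by
  classical
  refine ⟨fun j => f (Pi.single j 1), fun x => ?_⟩
  have h := LinearMap.pi_apply_eq_sum_univ f.toLinearMap x
  simp only [ContinuousLinearMap.coe_coe] at h
  rw [h, dotProduct]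
  refine Finset.sum_congr rfl fun j _ => ?_
  rw [smul_eq_mul, mul_comm]
  congr 2
  ext k
  simp [Pi.single_apply, eq_comm]

theorem StrongDual.exists_eq_dotProduct_add_mul {ι : Type*} [Fintype ι]
    (f : StrongDual ℝ ((ι → ℝ) × ℝ)) :
    ∃ (y : ι → ℝ) (σ : ℝ), ∀ S r, f (S, r) = S ⬝ᵥ y + r * σ := by
  obtain ⟨y, hy⟩ := StrongDual.exists_eq_dotProduct
    (f.comp (ContinuousLinearMap.inl ℝ (ι → ℝ) ℝ))
  refine ⟨y, f (0, 1), fun S r => ?_⟩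
  have h1 : ((S, r) : (ι → ℝ) × ℝ) = (S, 0) + r • (0, 1) := by simp
  have h2 : f (S, 0) = y ⬝ᵥ S := by simpa using hy S
  rw [h1, map_add, map_smul, h2, dotProduct_comm, smul_eq_mul]

theorem IsPolyhedral.exists_feasible {d : ℕ} {P : Set (Fin d → ℝ)} (h : IsPolyhedral P) :
    ∃ (r : ℕ) (B : Matrix (Fin r) (Fin d) ℝ) (b : Fin r → ℝ), feasible B b = P := by
  obtain ⟨F, hF, rfl⟩ := h
  obtain ⟨r, e, he⟩ := hF.fin_param
  choose y hy using fun k => StrongDual.exists_eq_dotProduct (e k).1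
  refine ⟨r, Matrix.of y, fun k => (e k).2, ?_⟩
  ext x
  simp only [feasible, Set.mem_ofPred_eq, ← he.2, Set.forall_mem_range, hy]
  rfl

/-- Used for recession directions: a functional bounded below along a ray is nonnegative on its
direction. -/
theorem nonneg_of_forall_nat_lt_add_mul {u a b : ℝ} (h : ∀ n : ℕ, u < a + n * b) : 0 ≤ b := by
  by_contra! hb
  obtain ⟨n, hn⟩ := exists_nat_gt ((a - u) / -b)
  rw [div_lt_iff₀ (neg_pos.2 hb)] at hn
  linarith [h n]

/-- The cone is `{0}` plus itself, hence a polyhedron. Closedness is what permits strict separation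
in the Farkas argument below. -/
theorem isClosed_hull_of_finite {ι : Type*} [Finite ι] {s : Set ((ι → ℝ) × ℝ)} (hs : s.Finite) :
    IsClosed (PointedCone.hull ℝ s : Set ((ι → ℝ) × ℝ)) := by
  have h0 : IsPolyhedral ({0} : Set ((ι → ℝ) × ℝ)) := by
    have := (isPolyhedral_singleton_pi (0 : ι → ℝ)).prod
      (isPolyhedral_setOf_eq (ContinuousLinearMap.id ℝ ℝ) 0)
    convert this using 1
    ext ⟨x, r⟩
    simp
  simpa using (h0.add_hull hs).isClosed

/-- Strong duality of linear programming, with the value attained by the dual problem. -/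
theorem exists_dual_certificate {r d : ℕ} {B : Matrix (Fin r) (Fin d) ℝ} {b : Fin r → ℝ}
    (hne : (feasible B b).Nonempty) {w : Fin d → ℝ} {c : ℝ}
    (h : ∀ x ∈ feasible B b, c ≤ w ⬝ᵥ x) :
    ∃ u : Fin r → ℝ, 0 ≤ u ∧ Bᵀ *ᵥ u = w ∧ c ≤ b ⬝ᵥ u := by
  -- The generator `(0, -1)` supplies the slack in `c ≤ b ⬝ᵥ u`, so a certificate exists as soon as
  -- `(w, c)` lies in this cone.
  set s : Set ((Fin d → ℝ) × ℝ) := insert (0, -1) (Set.range fun k => (B k, b k)) with hs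
  have hfin : s.Finite := (Set.finite_range _).insert _
  have hmem : ∀ q ∈ PointedCone.hull ℝ s,
      ∃ u : Fin r → ℝ, 0 ≤ u ∧ Bᵀ *ᵥ u = q.1 ∧ q.2 ≤ b ⬝ᵥ u := by
    intro q hq
    induction hq using Submodule.span_induction with
    | mem q hq =>
      rcases hq with rfl | ⟨k, rfl⟩
      · exact ⟨0, le_rfl, by simp, by simp⟩
      · refine ⟨Pi.single k 1, Pi.single_nonneg.2 zero_le_one, ?_, by simp⟩
        ext j
        simp
    | zero => exact ⟨0, le_rfl, by simp, by simp⟩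
    | add p q _ _ hp hq =>
      obtain ⟨u, hu, hu1, hu2⟩ := hp
      obtain ⟨v, hv, hv1, hv2⟩ := hq
      refine ⟨u + v, add_nonneg hu hv, by rw [Matrix.mulVec_add, hu1, hv1]; rfl, ?_⟩
      rw [dotProduct_add]
      exact add_le_add hu2 hv2
    | smul a q _ hq =>
      obtain ⟨u, hu, hu1, hu2⟩ := hq
      refine ⟨(a : ℝ) • u, smul_nonneg a.2 hu, by rw [Matrix.mulVec_smul, hu1]; rfl, ?_⟩
      rw [dotProduct_smul]
      exact mul_le_mul_of_nonneg_left hu2 a.2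
  by_contra hcon
  have hnot : (w, c) ∉ (PointedCone.hull ℝ s : Set ((Fin d → ℝ) × ℝ)) := fun hq =>
    hcon (hmem _ hq)
  obtain ⟨f, u, hfu, hu⟩ := geometric_hahn_banach_point_closed
    (PointedCone.convex _) (isClosed_hull_of_finite hfin) hnot
  obtain ⟨y, σ, hf⟩ := StrongDual.exists_eq_dotProduct_add_mul f
  have hu0 : u < 0 := by simpa using hu 0 (zero_mem _)
  have hpos : ∀ q ∈ s, 0 ≤ f q := fun q hq =>
    nonneg_of_forall_nat_lt_add_mul (u := u) (a := 0) fun n => by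
      have := hu (n • q) ((PointedCone.hull ℝ s).nsmul_mem (Submodule.subset_span hq) n)
      rwa [map_nsmul, nsmul_eq_mul, ← zero_add (_ * _)] at this
  have hσ : σ ≤ 0 := by
    have := hpos (0, -1) (Set.mem_insert _ _)
    rw [hf] at this
    simpa using this
  have hB : ∀ k, 0 ≤ (B *ᵥ y) k + b k * σ := fun k => by
    have := hpos (B k, b k) (Set.mem_insert_of_mem _ ⟨k, rfl⟩)
    rwa [hf] at this
  rw [hf] at hfu
  -- If `σ < 0`, rescaling `y` gives a feasible point with value below `c`. If `σ = 0`, `y` is a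
  -- recession direction of the feasible set along which `w` decreases without bound.
  rcases hσ.lt_or_eq with hσ | rfl
  · have hx : (-σ)⁻¹ • y ∈ feasible B b := by
      intro k
      rw [Matrix.mulVec_smul, Pi.smul_apply, smul_eq_mul, inv_mul_eq_div,
        le_div_iff₀ (neg_pos.2 hσ)]
      linarith [hB k]
    have := h _ hx
    rw [dotProduct_smul, smul_eq_mul, inv_mul_eq_div, le_div_iff₀ (neg_pos.2 hσ)] at this
    linarith
  · obtain ⟨x₀, hx₀⟩ := hne
    have : 0 ≤ w ⬝ᵥ y := nonneg_of_forall_nat_lt_add_mul (u := c - 1) (a := w ⬝ᵥ x₀) fun n => by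
      have hx : x₀ + (n : ℝ) • y ∈ feasible B b := by
        intro k
        rw [Matrix.mulVec_add, Matrix.mulVec_smul]
        have h1 := hB k
        have h2 := hx₀ k
        simp only [mul_zero, add_zero] at h1
        simp only [Pi.add_apply, Pi.smul_apply, smul_eq_mul]
        nlinarith [mul_nonneg (Nat.cast_nonneg (α := ℝ) n) h1]
      have := h _ hx
      rw [dotProduct_add, dotProduct_smul, smul_eq_mul] at this
      linarith
    linarith

/-! ### The solvency cone and consistent prices -/

section Cone

variable {d : ℕ} {π : Matrix (Fin d) (Fin d) ℝ} {i : Fin d}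

theorem zero_mem_solvencyCone : (0 : Fin d → ℝ) ∈ solvencyCone π := Submodule.zero_mem _

theorem add_mem_solvencyCone {x y : Fin d → ℝ} (hx : x ∈ solvencyCone π)
    (hy : y ∈ solvencyCone π) : x + y ∈ solvencyCone π := Submodule.add_mem _ hx hy

theorem smul_mem_solvencyCone {c : ℝ} (hc : 0 ≤ c) {x : Fin d → ℝ} (hx : x ∈ solvencyCone π) :
    c • x ∈ solvencyCone π :=
  Submodule.smul_mem (PointedCone.hull ℝ _) (⟨c, hc⟩ : {c : ℝ // 0 ≤ c}) hx

theorem exchange_mem_solvencyCone (j k : Fin d) :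
    π j k • (Pi.single j 1 : Fin d → ℝ) - Pi.single k 1 ∈ solvencyCone π :=
  Submodule.subset_span (Or.inl ⟨j, k, rfl⟩)

theorem single_mem_solvencyCone (j : Fin d) : (Pi.single j 1 : Fin d → ℝ) ∈ solvencyCone π :=
  Submodule.subset_span (Or.inr ⟨j, rfl⟩)

theorem mem_solvencyCone_of_nonneg {x : Fin d → ℝ} (hx : 0 ≤ x) : x ∈ solvencyCone π := by
  have : x = ∑ j, x j • (Pi.single j 1 : Fin d → ℝ) := by
    ext k
    simp [Finset.sum_apply, Pi.single_apply]
  rw [this]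
  exact Submodule.sum_mem (PointedCone.hull ℝ _) fun j _ =>
    smul_mem_solvencyCone (hx j) (single_mem_solvencyCone j)

theorem IsPolyhedral.add_solvencyCone {P : Set (Fin d → ℝ)} (hP : IsPolyhedral P) :
    IsPolyhedral (P + solvencyCone π) := by
  refine hP.add_hull (.union ?_ ?_)
  · refine (Set.finite_range fun p : Fin d × Fin d =>
      π p.1 p.2 • (Pi.single p.1 1 : Fin d → ℝ) - Pi.single p.2 1).subset ?_
    rintro _ ⟨j, k, rfl⟩
    exact ⟨(j, k), rfl⟩
  · refine (Set.finite_range fun j : Fin d => (Pi.single j 1 : Fin d → ℝ)).subset ?_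
    rintro _ ⟨j, rfl⟩
    exact ⟨j, rfl⟩

theorem mem_posDual_solvencyCone {w : Fin d → ℝ} :
    w ∈ posDual (solvencyCone π) ↔ (∀ j k, w k ≤ π j k * w j) ∧ ∀ j, 0 ≤ w j := by
  constructor
  · refine fun h => ⟨fun j k => ?_, fun j => ?_⟩
    · simpa [dotProduct_sub] using h _ (exchange_mem_solvencyCone j k)
    · simpa using h _ (single_mem_solvencyCone j)
  · rintro ⟨h1, h2⟩ y hy
    induction hy using Submodule.span_induction with
    | mem y hy =>
      rcases hy with ⟨j, k, rfl⟩ | ⟨j, rfl⟩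
      · simpa [dotProduct_sub] using h1 j k
      · simpa using h2 j
    | zero => simp
    | add x y _ _ hx hy =>
      rw [dotProduct_add]
      exact add_nonneg hx hy
    | smul a x _ hx =>
      change 0 ≤ w ⬝ᵥ ((a : ℝ) • x)
      rw [dotProduct_smul]
      exact mul_nonneg a.2 hx

/-- Consistency gives `1 = S i ≤ π j i * S j`; hence the sign conditions of the dual cone need not
be imposed on prices. -/
theorem IsBidAsk.nonneg_of_mem_priceSet (hπ : IsBidAsk π) {S : Fin d → ℝ}
    (hS : S ∈ priceSet π i) (j : Fin d) : 0 ≤ S j := by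
  have h1 := hS.2 j i
  rw [hS.1] at h1
  exact (pos_of_mul_pos_right (one_pos.trans_le h1) (hπ.pos j i).le).le

theorem IsBidAsk.mem_priceSet_iff (hπ : IsBidAsk π) {S : Fin d → ℝ} :
    S ∈ priceSet π i ↔ S i = 1 ∧ S ∈ posDual (solvencyCone π) := by
  rw [mem_posDual_solvencyCone]
  exact ⟨fun h => ⟨h.1, h.2, hπ.nonneg_of_mem_priceSet h⟩, fun h => ⟨h.1, h.2.1⟩⟩

theorem IsBidAsk.isCompact_priceSet (hπ : IsBidAsk π) : IsCompact (priceSet π i) := by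
  have hsub : priceSet π i ⊆ Set.pi Set.univ fun j => Set.Icc 0 (π i j) := fun S hS j _ => by
    have h := hS.2 i j
    rw [hS.1, mul_one] at h
    exact ⟨hπ.nonneg_of_mem_priceSet hS j, h⟩
  refine (isCompact_univ_pi fun j => isCompact_Icc).of_isClosed_subset ?_ hsub
  simp only [priceSet, Set.ofPred_and, Set.ofPred_forall]
  exact (isClosed_eq (by fun_prop) (by fun_prop)).inter
    (isClosed_iInter fun j => isClosed_iInter fun k => isClosed_le (by fun_prop) (by fun_prop))

end Cone

/-! ### Support functions of solvent portfolio sets -/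

section Support

variable {d : ℕ} {π : Matrix (Fin d) (Fin d) ℝ} {i : Fin d}

/-- A nonempty closed convex set of portfolios that is stable under adding solvent portfolios. -/
structure IsSolvent (π : Matrix (Fin d) (Fin d) ℝ) (C : Set (Fin d → ℝ)) : Prop where
  isClosed : IsClosed C
  convex : Convex ℝ C
  nonempty : C.Nonempty
  add_mem : ∀ x ∈ C, ∀ k ∈ solvencyCone π, x + k ∈ C

/-- The hypograph of `S ↦ inf {Sᵀ x | x ∈ C}` on the set of consistent prices. -/
def supportHypo (C : Set (Fin d → ℝ)) (π : Matrix (Fin d) (Fin d) ℝ) (i : Fin d) :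
    Set ((Fin d → ℝ) × ℝ) :=
  {p | p.1 ∈ priceSet π i ∧ ∀ x ∈ C, p.2 ≤ p.1 ⬝ᵥ x}

/-- The bipolar theorem for solvent sets, in terms of prices in units of the numeraire. -/
theorem IsSolvent.mem_iff (hπ : IsBidAsk π) {C : Set (Fin d → ℝ)} (hC : IsSolvent π C)
    {x : Fin d → ℝ} : x ∈ C ↔ ∀ p ∈ supportHypo C π i, p.2 ≤ p.1 ⬝ᵥ x := by
  refine ⟨fun hx p hp => hp.2 x hx, fun h => ?_⟩
  by_contra hx
  obtain ⟨f, u, hfx, hu⟩ := geometric_hahn_banach_point_closed hC.convex hC.isClosed hx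
  obtain ⟨w, hw⟩ := StrongDual.exists_eq_dotProduct f
  simp only [hw] at hfx hu
  obtain ⟨y, hy⟩ := hC.nonempty
  have hdual : w ∈ posDual (solvencyCone π) := fun k hk =>
    nonneg_of_forall_nat_lt_add_mul (u := u) (a := w ⬝ᵥ y) fun n => by
      have := hu _ (hC.add_mem y hy _ (smul_mem_solvencyCone (Nat.cast_nonneg n) hk))
      rwa [dotProduct_add, dotProduct_smul, smul_eq_mul] at this
  have hdual' := mem_posDual_solvencyCone.1 hdual
  -- Since `w j ≤ π i j * w i`, a vanishing `w i` would force `w = 0`, which separates nothing. Thus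
  -- `w` can be normalised to a price vector.
  have hwi : 0 < w i := by
    refine (hdual'.2 i).lt_of_ne fun h0 => ?_
    have hw0 : w = 0 := by
      ext j
      have := hdual'.1 i j
      rw [← h0, mul_zero] at this
      exact le_antisymm this (hdual'.2 j)
    have := hu y hy
    simp only [hw0, zero_dotProduct] at hfx this
    exact lt_asymm hfx this
  have hS : ((w i)⁻¹ • w, (w i)⁻¹ * u) ∈ supportHypo C π i := by
    refine ⟨hπ.mem_priceSet_iff.2 ⟨by simp [hwi.ne'], fun k hk => ?_⟩, fun z hz => ?_⟩
    · rw [smul_dotProduct]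
      exact mul_nonneg (inv_nonneg.2 hwi.le) (hdual k hk)
    · rw [smul_dotProduct]
      exact mul_le_mul_of_nonneg_left (hu z hz).le (inv_nonneg.2 hwi.le)
  have := h _ hS
  simp only [smul_dotProduct, smul_eq_mul] at this
  exact absurd (le_of_mul_le_mul_left this (inv_pos.2 hwi)) (not_le.2 hfx)

/-- The closed convex hull of the hypographs of support functions is the hypograph of the support
function of the intersection. -/
theorem mem_closure_convexHull_supportHypo_iff {ι : Type*} {Q : ι → Matrix (Fin d) (Fin d) ℝ}
    (hQ : ∀ a, IsBidAsk (Q a)) {C : ι → Set (Fin d → ℝ)} (hC : ∀ a, IsSolvent (Q a) (C a))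
    (hne : (⋂ a, C a).Nonempty) {S : Fin d → ℝ} (hS : S i = 1) {r : ℝ} :
    (S, r) ∈ closure (convexHull ℝ (⋃ a, supportHypo (C a) (Q a) i)) ↔
      ∀ x ∈ ⋂ a, C a, r ≤ S ⬝ᵥ x := by
  set U := ⋃ a, supportHypo (C a) (Q a) i with hU
  have hmem : ∀ x, x ∈ ⋂ a, C a ↔ ∀ p ∈ U, p.2 ≤ p.1 ⬝ᵥ x := by
    intro x
    rw [Set.mem_iInter, forall_congr' fun a => (hC a).mem_iff (i := i) (hQ a)]
    simp only [hU, Set.mem_iUnion]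
    exact ⟨fun h p ⟨a, ha⟩ => h a p ha, fun h a p ha => h p ⟨a, ha⟩⟩
  constructor
  · intro h x hx
    have hsub : closure (convexHull ℝ U) ⊆ {p : (Fin d → ℝ) × ℝ | p.2 ≤ p.1 ⬝ᵥ x} := by
      refine closure_minimal (convexHull_min ((hmem x).1 hx) ?_)
        (isClosed_le (by fun_prop) (by fun_prop))
      intro p hp q hq a b ha hb _
      simp only [Set.mem_ofPred_eq, Prod.fst_add, Prod.snd_add, Prod.smul_fst, Prod.smul_snd,
        add_dotProduct, smul_dotProduct] at hp hq ⊢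
      exact add_le_add (smul_le_smul_of_nonneg_left hp ha) (smul_le_smul_of_nonneg_left hq hb)
    exact hsub h
  · intro h
    by_contra hcon
    obtain ⟨f, u, hfu, hu⟩ := geometric_hahn_banach_point_closed
      (convex_convexHull ℝ U).closure isClosed_closure hcon
    obtain ⟨y, σ, hf⟩ := StrongDual.exists_eq_dotProduct_add_mul f
    have hu' : ∀ p ∈ U, u < p.1 ⬝ᵥ y + p.2 * σ := fun p hp => by
      rw [← hf]
      exact hu _ (subset_closure (subset_convexHull ℝ U hp))
    have hUi : ∀ p ∈ U, p.1 i = 1 := fun p hp => by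
      obtain ⟨a, ha⟩ := Set.mem_iUnion.1 hp
      exact ha.1.1
    -- On the slice `R i = 1` constants are linear: adding `c` units of the numéraire adds `c`. This
    -- turns affine separating functionals into portfolios.
    have hshift : ∀ R : Fin d → ℝ, R i = 1 → ∀ z c,
        R ⬝ᵥ (z + c • (Pi.single i 1 : Fin d → ℝ)) = R ⬝ᵥ z + c := fun R hR z c => by
      simp [dotProduct_add, hR]
    rw [hf] at hfu
    obtain ⟨x₀, hx₀⟩ := hne
    -- `U` is stable under lowering the value, which excludes `σ > 0` unless `U` is empty. Emptiness
    -- can occur, for instance when every `C a` is the whole space.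
    have key : σ < 0 ∨ (σ = 0 ∨ U = ∅) := by
      rcases Set.eq_empty_or_nonempty U with h0 | ⟨p, hp⟩
      · exact Or.inr (Or.inr h0)
      rcases lt_trichotomy σ 0 with h | h | h
      · exact Or.inl h
      · exact Or.inr (Or.inl h)
      · exfalso
        have : 0 ≤ -σ := nonneg_of_forall_nat_lt_add_mul (u := u) (a := p.1 ⬝ᵥ y + p.2 * σ)
          fun n => by
            obtain ⟨a, ha⟩ := Set.mem_iUnion.1 hp
            have h1 : (p.1, p.2 - n) ∈ U := Set.mem_iUnion.2 ⟨a, ha.1, fun x hx =>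
              (sub_le_self _ (Nat.cast_nonneg n)).trans (ha.2 x hx)⟩
            have := hu' _ h1
            simp only at this
            linarith
        linarith
    -- A non-vertical hyperplane is the graph of a portfolio in the intersection that violates `h`.
    -- Otherwise there is a recession direction `z` of the intersection with `S ⬝ᵥ z < 0`, again
    -- contradicting `h`.
    rcases key with hσ | hσ
    · have hx : (-σ)⁻¹ • y + (-u * (-σ)⁻¹) • (Pi.single i 1 : Fin d → ℝ) ∈ ⋂ a, C a := by
        refine (hmem _).2 fun p hp => ?_
        rw [hshift _ (hUi p hp), dotProduct_smul, smul_eq_mul, inv_mul_eq_div, ← div_eq_mul_inv,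
          ← add_div, le_div_iff₀ (neg_pos.2 hσ)]
        linarith [hu' p hp]
      have := h _ hx
      rw [hshift _ hS, dotProduct_smul, smul_eq_mul, inv_mul_eq_div, ← div_eq_mul_inv,
        ← add_div, le_div_iff₀ (neg_pos.2 hσ)] at this
      linarith
    · obtain ⟨z, hz, hSz⟩ : ∃ z : Fin d → ℝ, (∀ p ∈ U, 0 ≤ p.1 ⬝ᵥ z) ∧ S ⬝ᵥ z < 0 := by
        rcases hσ with rfl | h0
        · refine ⟨y + (-u) • (Pi.single i 1 : Fin d → ℝ), fun p hp => ?_, ?_⟩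
          · rw [hshift _ (hUi p hp)]
            linarith [hu' p hp]
          · rw [hshift _ hS]
            linarith
        · exact ⟨-Pi.single i 1, by simp [h0], by simp [hS]⟩
      have : 0 ≤ S ⬝ᵥ z := nonneg_of_forall_nat_lt_add_mul (u := r - 1) (a := S ⬝ᵥ x₀)
        fun n => by
          have hx : x₀ + (n : ℝ) • z ∈ ⋂ a, C a := by
            refine (hmem _).2 fun p hp => ?_
            rw [dotProduct_add, dotProduct_smul, smul_eq_mul]
            nlinarith [(hmem _).1 hx₀ p hp, mul_nonneg (Nat.cast_nonneg (α := ℝ) n) (hz p hp)]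
          have := h _ hx
          rw [dotProduct_add, dotProduct_smul, smul_eq_mul] at this
          linarith
      linarith

theorem isClosed_supportHypo (hπ : IsBidAsk π) (C : Set (Fin d → ℝ)) :
    IsClosed (supportHypo C π i) := by
  simp only [supportHypo, Set.ofPred_and, Set.ofPred_forall]
  exact (hπ.isCompact_priceSet.isClosed.preimage continuous_fst).inter
    (isClosed_biInter fun x _ => isClosed_le (by fun_prop) (by fun_prop))

/-- An affine inequality that holds at the vertices of the hypograph of a support function holds on
the hypograph. -/
theorem le_dotProduct_of_forall_extremePoints (hπ : IsBidAsk π) {C : Set (Fin d → ℝ)}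
    (hC : C.Nonempty) {x : Fin d → ℝ}
    (h : ∀ p ∈ (supportHypo C π i).extremePoints ℝ, p.2 ≤ p.1 ⬝ᵥ x) :
    ∀ p ∈ supportHypo C π i, p.2 ≤ p.1 ⬝ᵥ x := by
  intro p₀ hp₀
  set H := supportHypo C π i with hH
  obtain ⟨x₀, hx₀⟩ := hC
  let l : StrongDual ℝ ((Fin d → ℝ) × ℝ) := ContinuousLinearMap.snd ℝ _ _ -
    LinearMap.toContinuousLinearMap
      ((dotProductBilin ℝ ℝ).flip x ∘ₗ LinearMap.fst ℝ (Fin d → ℝ) ℝ)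
  have hl : ∀ p, l p = p.2 - p.1 ⬝ᵥ x := fun p => rfl
  -- The hypograph is unbounded below, but a superlevel set of `l` is compact: prices are bounded,
  -- `x₀` bounds the values above, and `l p₀ ≤ l p` bounds them below.
  set K : Set ((Fin d → ℝ) × ℝ) := H ∩ {p | l p₀ ≤ l p} with hK
  have hKclosed : IsClosed K := (isClosed_supportHypo hπ C).inter
    (isClosed_le continuous_const l.continuous)
  obtain ⟨M₁, hM₁⟩ := (hπ.isCompact_priceSet (i := i)).bddAbove_image
    (f := fun S => S ⬝ᵥ x₀) (by fun_prop)
  obtain ⟨M₂, hM₂⟩ := (hπ.isCompact_priceSet (i := i)).bddBelow_image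
    (f := fun S => l p₀ + S ⬝ᵥ x) (by fun_prop)
  have hKcompact : IsCompact K := by
    refine ((hπ.isCompact_priceSet (i := i)).prod (isCompact_Icc (a := M₂) (b := M₁))).of_isClosed_subset
      hKclosed ?_
    rintro p ⟨hp, hlp⟩
    refine ⟨hp.1, ?_, (hp.2 x₀ hx₀).trans (hM₁ ⟨_, hp.1, rfl⟩)⟩
    have h1 : M₂ ≤ l p₀ + p.1 ⬝ᵥ x := hM₂ ⟨_, hp.1, rfl⟩
    have h2 : l p₀ ≤ p.2 - p.1 ⬝ᵥ x := hlp
    linarith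
  obtain ⟨p₁, hp₁, hmax⟩ := hKcompact.exists_isMaxOn ⟨p₀, hp₀, le_refl (l p₀)⟩ l.continuous.continuousOn
  have hmax' : ∀ q ∈ H, l q ≤ l p₁ := fun q hq => by
    by_cases hq0 : l p₀ ≤ l q
    · exact hmax ⟨hq, hq0⟩
    · exact (not_le.1 hq0).le.trans hp₁.2
  -- The maximisers of `l` form a nonempty compact exposed face; an extreme point of it is a vertex
  -- of `H` at which `l` is at least `l p₀`.
  have hexp : IsExposed ℝ H (l.toExposed H) := ContinuousLinearMap.toExposed.isExposed
  have hcomp : IsCompact (l.toExposed H) := by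
    refine hKcompact.of_isClosed_subset (hexp.isClosed (isClosed_supportHypo hπ C)) ?_
    exact fun q hq => ⟨hq.1, hq.2 p₀ hp₀⟩
  obtain ⟨e, he⟩ := hcomp.extremePoints_nonempty ⟨p₁, hp₁.1, hmax'⟩
  have h1 := h e (hexp.isExtreme.extremePoints_subset_extremePoints he)
  have h2 : l p₀ ≤ l e := he.1.2 p₀ hp₀
  rw [hl, hl] at h2
  linarith

/-- A point strictly below the graph is the midpoint of a vertical segment inside the hypograph. -/
theorem eq_of_mem_extremePoints_hypo {f : (Fin d → ℝ) → EReal} {S : Fin d → ℝ} {v : ℝ}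
    (h : (S, v) ∈ (hypo f).extremePoints ℝ) : f S = v := by
  refine le_antisymm (not_lt.1 fun hlt => ?_) h.1
  obtain ⟨v', hv, hv'⟩ := EReal.lt_iff_exists_real_btwn.1 hlt
  have hvv : v < v' := EReal.coe_lt_coe_iff.1 hv
  have h1 : (S, v') ∈ hypo f := hv'.le
  have h2 : (S, 2 * v - v') ∈ hypo f :=
    (EReal.coe_le_coe_iff.2 (by linarith : 2 * v - v' ≤ v)).trans h.1
  have := h.2 h1 h2 ⟨1 / 2, 1 / 2, by norm_num, by norm_num, by norm_num, by
    ext1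
    · rw [Prod.fst_add, Prod.smul_fst, Prod.smul_fst, ← add_smul]
      norm_num
    · simp only [Prod.snd_add, Prod.smul_snd, smul_eq_mul]
      ring⟩
  exact hvv.ne' (congrArg Prod.snd this)

/-- The hypograph of the support function is the lower image of the geometric dual problem. -/
theorem omitCoord_image_supportHypo (hπ : IsBidAsk π) {r : ℕ} {B : Matrix (Fin r) (Fin d) ℝ}
    {b : Fin r → ℝ} (hne : (upperImage 1 B b (solvencyCone π)).Nonempty) :
    omitCoord i '' supportHypo (upperImage 1 B b (solvencyCone π)) π i =
      lowerImage 1 B b (solvencyCone π) (Pi.single i 1) i := by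
  have himg : upperImage 1 B b (solvencyCone π) = feasible B b + solvencyCone π := by
    simp [upperImage]
  rw [himg] at hne ⊢
  have hfeas : (feasible B b).Nonempty := hne.of_add_left
  ext z
  simp only [lowerImage, Set.mem_sub, Set.mem_image]
  constructor
  · rintro ⟨⟨S, v⟩, ⟨hS, hv⟩, rfl⟩
    have hv' : ∀ x ∈ feasible B b, v ≤ S ⬝ᵥ x := fun x hx =>
      hv x ⟨x, hx, 0, zero_mem_solvencyCone, add_zero x⟩
    obtain ⟨u, hu, hBu, hbu⟩ := exists_dual_certificate hfeas hv'
    refine ⟨_, ⟨(u, S), ⟨hu, by simpa using hBu, by simpa using hS.1,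
      (hπ.mem_priceSet_iff.1 hS).2⟩, rfl⟩, (0, b ⬝ᵥ u - v), ⟨rfl, sub_nonneg.2 hbu⟩, ?_⟩
    simp [omitCoord]
  · rintro ⟨_, ⟨⟨u, w⟩, ⟨hu, hBu, hw, hwK⟩, rfl⟩, ⟨z0, s⟩, ⟨hz0, hs⟩, rfl⟩
    simp only at hu hBu hwK hz0 hs
    subst hz0
    have hwi : w i = 1 := by simpa using hw
    rw [Matrix.transpose_one, Matrix.one_mulVec] at hBu
    refine ⟨(w, b ⬝ᵥ u - s), ⟨hπ.mem_priceSet_iff.2 ⟨hwi, hwK⟩, ?_⟩, by simp [omitCoord]⟩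
    rintro _ ⟨x, hx, k, hk, rfl⟩
    -- Weak duality; the converse inclusion above used strong duality.
    have h1 : b ⬝ᵥ u ≤ (B *ᵥ x) ⬝ᵥ u := dotProduct_le_dotProduct_of_nonneg_right hx hu
    have h2 : (B *ᵥ x) ⬝ᵥ u = w ⬝ᵥ x := by
      rw [← hBu, Matrix.mulVec_transpose, dotProduct_comm, Matrix.dotProduct_mulVec]
    have h3 := hwK k hk
    simp only [dotProduct_add]
    linarith

end Support

/-! ### The recursion for superhedging portfolios -/

section Recursion

variable {Ω : Type*} {m : MeasurableSpace Ω} {d : ℕ} {ℱ : Filtration ℕ m} {T : ℕ}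
  {π : ℕ → Ω → Matrix (Fin d) (Fin d) ℝ} {X : Ω → Fin d → ℝ} {i : Fin d}

/-- The portfolios at time `t` that allow to superhedge `X` without trading at time `t`. -/
def continuationSet (ℱ : Filtration ℕ m) (T : ℕ) (π : ℕ → Ω → Matrix (Fin d) (Fin d) ℝ)
    (X : Ω → Fin d → ℝ) (t : ℕ) (ω : Ω) : Set (Fin d → ℝ) :=
  {x | if t < T then ∀ ω' ∈ node ℱ t ω, x ∈ SHP ℱ T π X (t + 1) ω' else x = X ω}

theorem continuationSet_of_lt {t : ℕ} (ht : t < T) (ω : Ω) :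
    continuationSet ℱ T π X t ω = ⋂ ω' ∈ node ℱ t ω, SHP ℱ T π X (t + 1) ω' := by
  ext x
  simp [continuationSet, ht]

theorem continuationSet_self (ω : Ω) : continuationSet ℱ T π X T ω = {X ω} := by
  ext x
  simp [continuationSet]

theorem SHP_eq {t : ℕ} (ht : t ≤ T) (ω : Ω) :
    SHP ℱ T π X t ω = continuationSet ℱ T π X t ω + solvencyCone (π t ω) := by
  rw [SHP]
  rcases ht.lt_or_eq with h | rfl
  · rw [dif_pos h, continuationSet_of_lt h]
  · rw [dif_neg (lt_irrefl _), continuationSet_self]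

theorem mem_node_self {t : ℕ} (ω : Ω) : ω ∈ node ℱ t ω := @mem_measurableAtom_self _ (ℱ t) ω

theorem node_eq {t : ℕ} {ω ω' : Ω} (h : ω' ∈ node ℱ t ω) : node ℱ t ω' = node ℱ t ω :=
  @measurableAtom_eq_of_mem _ (ℱ t) _ _ h

/-- Nonnegative portfolios are solvent, so a componentwise upper bound of one point from each set
lies in all of them. -/
theorem IsSolvent.iInter_nonempty {ι : Type*} [Finite ι] {Q : ι → Matrix (Fin d) (Fin d) ℝ}
    {C : ι → Set (Fin d → ℝ)} (hC : ∀ a, IsSolvent (Q a) (C a)) : (⋂ a, C a).Nonempty := by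
  choose x hx using fun a => (hC a).nonempty
  obtain ⟨y, hy⟩ := (Set.finite_range x).bddAbove
  refine ⟨y, Set.mem_iInter.2 fun a => ?_⟩
  rw [← add_sub_cancel (x a) y]
  exact (hC a).add_mem _ (hx a) _ (mem_solvencyCone_of_nonneg (sub_nonneg.2 (hy ⟨a, rfl⟩)))

theorem IsPolyhedral.isSolvent_add {Q : Matrix (Fin d) (Fin d) ℝ} {P : Set (Fin d → ℝ)}
    (hP : IsPolyhedral P) (hne : P.Nonempty) : IsSolvent Q (P + solvencyCone Q) where
  isClosed := hP.add_solvencyCone.isClosed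
  convex := hP.add_solvencyCone.convex
  nonempty := hne.add ⟨0, zero_mem_solvencyCone⟩
  add_mem := by
    rintro _ ⟨x, hx, k, hk, rfl⟩ l hl
    exact ⟨x, hx, k + l, add_mem_solvencyCone hk hl, (add_assoc x k l).symm⟩

/-- Polyhedrality, unlike mere closedness, survives both intersection and the addition of `K_t`, so
it is the property carried through the backward induction. -/
theorem isPolyhedral_continuationSet [Finite Ω] {t : ℕ} (ht : t ≤ T) (ω : Ω) :
    IsPolyhedral (continuationSet ℱ T π X t ω) ∧ (continuationSet ℱ T π X t ω).Nonempty := by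
  induction ht using Nat.decreasingInduction generalizing ω with
  | self =>
    rw [continuationSet_self]
    exact ⟨isPolyhedral_singleton_pi _, Set.singleton_nonempty _⟩
  | of_succ t ht ih =>
    rw [continuationSet_of_lt ht]
    constructor
    · refine .iInter fun ω' => .iInter fun _ => ?_
      rw [SHP_eq ht]
      exact (ih ω').1.add_solvencyCone
    · rw [Set.biInter_eq_iInter]
      refine IsSolvent.iInter_nonempty (Q := fun ω' : node ℱ t ω => π (t + 1) ω') fun ω' => ?_
      rw [SHP_eq ht]
      exact (ih ω').1.isSolvent_add (ih ω').2

theorem isPolyhedral_SHP [Finite Ω] {t : ℕ} (ht : t ≤ T) (ω : Ω) :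
    IsPolyhedral (SHP ℱ T π X t ω) := by
  rw [SHP_eq ht]
  exact (isPolyhedral_continuationSet ht ω).1.add_solvencyCone

theorem isSolvent_SHP [Finite Ω] {t : ℕ} (ht : t ≤ T) (ω : Ω) :
    IsSolvent (π t ω) (SHP ℱ T π X t ω) := by
  rw [SHP_eq ht]
  exact (isPolyhedral_continuationSet ht ω).1.isSolvent_add (isPolyhedral_continuationSet ht ω).2

/-- Consistent prices value solvent portfolios nonnegatively, so the possibility of trading does not
lower the infimum. -/
theorem IsBidAsk.forall_mem_add_solvencyCone_iff {Q : Matrix (Fin d) (Fin d) ℝ} (hQ : IsBidAsk Q)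
    {S : Fin d → ℝ} (hS : S ∈ priceSet Q i) {D : Set (Fin d → ℝ)} {r : ℝ} :
    (∀ x ∈ D + solvencyCone Q, r ≤ S ⬝ᵥ x) ↔ ∀ x ∈ D, r ≤ S ⬝ᵥ x := by
  constructor
  · exact fun h x hx => h x ⟨x, hx, 0, zero_mem_solvencyCone, add_zero x⟩
  · rintro h _ ⟨x, hx, k, hk, rfl⟩
    have := (hQ.mem_priceSet_iff.1 hS).2 k hk
    simp only [dotProduct_add]
    linarith [h x hx]

/-- The scalar algorithm computes the support functions of the sets of superhedging portfolios. -/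
theorem hypo_scalarV [Finite Ω] (hπ : ∀ t ≤ T, ∀ ω, IsBidAsk (π t ω)) {t : ℕ} (ht : t ≤ T)
    (ω : Ω) :
    hypo (scalarV ℱ T π X i t ω) = supportHypo (SHP ℱ T π X t ω) (π t ω) i := by
  induction ht using Nat.decreasingInduction generalizing ω with
  | self =>
    ext ⟨S, r⟩
    by_cases hS : S ∈ priceSet (π T ω) i
    · rw [supportHypo, Set.mem_ofPred_eq, SHP_eq le_rfl,
        (hπ T le_rfl ω).forall_mem_add_solvencyCone_iff hS, continuationSet_self]
      simp [hypo, scalarV, hS, dotProduct_comm]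
    · simp [hypo, scalarV, supportHypo, hS]
  | of_succ t ht ih =>
    ext ⟨S, r⟩
    by_cases hS : S ∈ priceSet (π t ω) i
    · rw [supportHypo, Set.mem_ofPred_eq, SHP_eq ht.le,
        (hπ t ht.le ω).forall_mem_add_solvencyCone_iff hS, continuationSet_of_lt ht,
        Set.biInter_eq_iInter]
      have hunion : (⋃ f ∈ {f | ∃ ω' ∈ node ℱ t ω,
          f = fun S' => scalarV ℱ T π X i (t + 1) ω' S'}, hypo f) =
          ⋃ ω' : node ℱ t ω, supportHypo (SHP ℱ T π X (t + 1) ω') (π (t + 1) ω') i := by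
        ext p
        simp only [Set.mem_iUnion, Set.mem_ofPred_eq, ← ih]
        constructor
        · rintro ⟨_, ⟨ω', hω', rfl⟩, hp⟩
          exact ⟨⟨ω', hω'⟩, hp⟩
        · rintro ⟨⟨ω', hω'⟩, hp⟩
          exact ⟨_, ⟨ω', hω', rfl⟩, hp⟩
      have hsolv : ∀ ω' : node ℱ t ω, IsSolvent (π (t + 1) ω') (SHP ℱ T π X (t + 1) ω') :=
        fun ω' => isSolvent_SHP (t := t + 1) ht (ω' : Ω)
      rw [← mem_closure_convexHull_supportHypo_iff (fun ω' : node ℱ t ω => hπ (t + 1) ht ω') hsolv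
        (IsSolvent.iInter_nonempty hsolv) hS.1, ← hunion, ← hypo_cap]
      simp only [hypo, Set.mem_ofPred_eq, hS, true_and]
      rw [scalarV, if_pos hS, dif_pos ht]
    · simp only [hypo, supportHypo, Set.mem_ofPred_eq, hS, false_and, iff_false, not_le]
      rw [scalarV, if_neg hS]
      exact EReal.bot_lt_coe r

end Recursion

/-! ### Self-financing portfolio processes -/

section SelfFinancing

/-- Every preimage is a countable union of atoms. Adaptedness thus reduces to constancy on nodes. -/
theorem measurable_of_forall_mem_measurableAtom {Ω γ : Type*} [Countable Ω] {m : MeasurableSpace Ω}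
    [MeasurableSpace γ] {f : Ω → γ} (h : ∀ x, ∀ y ∈ measurableAtom x, f y = f x) :
    Measurable f := by
  intro s _
  have : f ⁻¹' s = ⋃ x ∈ f ⁻¹' s, measurableAtom x := by
    ext y
    simp only [Set.mem_iUnion, Set.mem_preimage, exists_prop]
    exact ⟨fun hy => ⟨y, hy, mem_measurableAtom_self y⟩,
      fun ⟨x, hx, hyx⟩ => by rwa [h x y hyx]⟩
  rw [this]
  exact .biUnion (Set.to_countable _) fun x _ => .measurableAtom_of_countable x

theorem eq_of_mem_measurableAtom {Ω γ : Type*} {m : MeasurableSpace Ω} [MeasurableSpace γ]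
    [MeasurableSingletonClass γ] {f : Ω → γ} (hf : Measurable f) {x y : Ω}
    (h : y ∈ measurableAtom x) : f y = f x :=
  mem_of_mem_measurableAtom h (hf (measurableSet_singleton (f x))) rfl

theorem ae_iff_forall_of_singleton_pos {Ω : Type*} {m : MeasurableSpace Ω} {P : Measure Ω}
    (hP : ∀ ω, 0 < P {ω}) {p : Ω → Prop} : (∀ᵐ ω ∂P, p ω) ↔ ∀ ω, p ω := by
  refine ⟨fun h ω => ?_, fun h => .of_forall h⟩
  by_contra hω
  exact (hP ω).ne' (measure_mono_null (Set.singleton_subset_iff.2 hω) h)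

variable {Ω : Type*} {m : MeasurableSpace Ω} {d : ℕ} {ℱ : Filtration ℕ m} {T : ℕ}
  {π : ℕ → Ω → Matrix (Fin d) (Fin d) ℝ} {X : Ω → Fin d → ℝ}

theorem continuationSet_congr {t : ℕ} (ht : t ≤ T) (hX : Measurable[ℱ T] X) {ω ω' : Ω}
    (h : ω' ∈ node ℱ t ω) : continuationSet ℱ T π X t ω' = continuationSet ℱ T π X t ω := by
  rcases ht.lt_or_eq with ht | rfl
  · rw [continuationSet_of_lt ht, continuationSet_of_lt ht, node_eq h]
  · rw [continuationSet_self, continuationSet_self, eq_of_mem_measurableAtom hX h]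

open scoped Classical in
/-- A portfolio in `D` into which `x` can be transformed by trading, if there is one. -/
noncomputable def trade (D : Set (Fin d → ℝ)) (Q : Matrix (Fin d) (Fin d) ℝ) (x : Fin d → ℝ) :
    Fin d → ℝ :=
  if h : ∃ y ∈ D, x - y ∈ solvencyCone Q then h.choose else 0

theorem trade_spec {D : Set (Fin d → ℝ)} {Q : Matrix (Fin d) (Fin d) ℝ} {x : Fin d → ℝ}
    (h : x ∈ D + solvencyCone Q) : trade D Q x ∈ D ∧ x - trade D Q x ∈ solvencyCone Q := by
  have h' : ∃ y ∈ D, x - y ∈ solvencyCone Q := by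
    obtain ⟨y, hy, k, hk, rfl⟩ := h
    exact ⟨y, hy, by simpa using hk⟩
  rw [trade, dif_pos h']
  exact h'.choose_spec

/-- A superhedging strategy with initial portfolio `x₀`. -/
noncomputable def hedge (ℱ : Filtration ℕ m) (T : ℕ) (π : ℕ → Ω → Matrix (Fin d) (Fin d) ℝ)
    (X : Ω → Fin d → ℝ) (x₀ : Fin d → ℝ) : ℕ → Ω → Fin d → ℝ
  | 0, ω => trade (continuationSet ℱ T π X 0 ω) (π 0 ω) x₀
  | t + 1, ω => trade (continuationSet ℱ T π X (t + 1) ω) (π (t + 1) ω) (hedge ℱ T π X x₀ t ω)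

/-- The choice in `trade` depends on `ω` only through the target set, the bid-ask matrix and the
current portfolio, all of which are constant on the node. -/
theorem hedge_congr (hπmeas : ∀ t ≤ T, ∀ j k, Measurable[ℱ t] fun ω => π t ω j k)
    (hX : Measurable[ℱ T] X) {x₀ : Fin d → ℝ} {t : ℕ} (ht : t ≤ T) {ω ω' : Ω}
    (h : ω' ∈ node ℱ t ω) : hedge ℱ T π X x₀ t ω' = hedge ℱ T π X x₀ t ω := by
  have hπ' : ∀ t ≤ T, ω' ∈ node ℱ t ω → π t ω' = π t ω := fun t ht h => by
    ext j k
    exact eq_of_mem_measurableAtom (hπmeas t ht j k) h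
  induction t with
  | zero => rw [hedge, hedge, continuationSet_congr ht hX h, hπ' 0 ht h]
  | succ t ih =>
    have h' : ω' ∈ node ℱ t ω := by
      simp only [node, measurableAtom, Set.mem_iInter] at h ⊢
      exact fun s hs hm => h s hs (ℱ.mono t.le_succ s hm)
    rw [hedge, hedge, continuationSet_congr ht hX h, hπ' _ ht h,
      ih (t.le_succ.trans ht) h']

/-- A portfolio in the continuation set lies in `SHP` at every successor, so the next trade exists
and the default value of `trade` is never reached. -/
theorem hedge_mem {x₀ : Fin d → ℝ} (hx₀ : ∀ ω, x₀ ∈ SHP ℱ T π X 0 ω) {t : ℕ} (ht : t ≤ T)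
    (ω : Ω) : hedge ℱ T π X x₀ t ω ∈ continuationSet ℱ T π X t ω := by
  induction t with
  | zero =>
    have := hx₀ ω
    rw [SHP_eq ht] at this
    exact (trade_spec this).1
  | succ t ih =>
    have := ih (t.le_succ.trans ht)
    rw [continuationSet_of_lt ht, Set.mem_iInter₂] at this
    have := this ω (mem_node_self ω)
    rw [SHP_eq ht] at this
    exact (trade_spec this).1

/-- The recursively defined set of portfolios is the set of superhedging initial portfolios. -/
theorem mem_initialSuperhedging_iff [Finite Ω] {P : Measure Ω} (hP : ∀ ω, 0 < P {ω})
    (hπmeas : ∀ t ≤ T, ∀ j k, Measurable[ℱ t] fun ω => π t ω j k)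
    (hX : Measurable[ℱ T] X) {x₀ : Fin d → ℝ} :
    x₀ ∈ initialSuperhedging P ℱ T π X ↔ ∀ ω, x₀ ∈ SHP ℱ T π X 0 ω := by
  constructor
  · rintro ⟨V, hV, hVX⟩
    have hVX' := (ae_iff_forall_of_singleton_pos hP).1 hVX
    have hinit := (ae_iff_forall_of_singleton_pos hP).1 hV.initial
    have hstep := fun t ht => (ae_iff_forall_of_singleton_pos hP).1 (hV.step t ht)
    have key : ∀ t (_ : t ≤ T) ω, x₀ + V t ω ∈ continuationSet ℱ T π X t ω := by
      intro t ht
      induction ht using Nat.decreasingInduction with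
      | self =>
        intro ω
        rw [continuationSet_self, hVX' ω]
        simp
      | of_succ t ht ih =>
        intro ω
        rw [continuationSet_of_lt ht, Set.mem_iInter₂]
        intro ω' hω'
        -- By adaptedness the portfolio at `ω` is also the one at `ω'`, from which the time `t + 1`
        -- trade starts.
        rw [← eq_of_mem_measurableAtom (hV.adapted t ht.le) hω', SHP_eq ht]
        refine ⟨_, ih ω', _, hstep t ht ω', ?_⟩
        simp
    intro ω
    rw [SHP_eq (Nat.zero_le T)]
    exact ⟨_, key 0 (Nat.zero_le T) ω, _, hinit ω, by simp⟩
  · intro hx₀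
    -- Subtracting `x₀` makes the process start from the zero portfolio before the first trade.
    refine ⟨fun t ω => hedge ℱ T π X x₀ t ω - x₀, ⟨fun t ht => ?_, .of_forall fun ω => ?_,
      fun t ht => .of_forall fun ω => ?_⟩, .of_forall fun ω => ?_⟩
    · refine @measurable_of_forall_mem_measurableAtom _ _ _ (ℱ t) _ _ fun ω ω' h => ?_
      simp only [hedge_congr hπmeas hX ht h]
    · have := hx₀ ω
      rw [SHP_eq (Nat.zero_le T)] at this
      rw [Set.mem_neg, neg_sub]
      exact (trade_spec this).2
    · have h1 := hedge_mem hx₀ ht.le ω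
      rw [continuationSet_of_lt ht, Set.mem_iInter₂] at h1
      have h2 := h1 ω (mem_node_self ω)
      rw [SHP_eq ht] at h2
      rw [Set.mem_neg, neg_sub, sub_sub_sub_cancel_right]
      exact (trade_spec h2).2
    · have := hedge_mem hx₀ le_rfl ω
      rw [continuationSet_self, Set.mem_singleton_iff] at this
      simp only [this]

/-- The trivial σ-algebra has a single node, so the recursion ends in one deterministic set. -/
theorem SHP_zero_congr (hℱ : ℱ 0 = ⊥)
    (hπmeas : ∀ t ≤ T, ∀ j k, Measurable[ℱ t] fun ω => π t ω j k)
    (hX : Measurable[ℱ T] X) (ω ω' : Ω) : SHP ℱ T π X 0 ω' = SHP ℱ T π X 0 ω := by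
  have h : ω' ∈ node ℱ 0 ω := by
    simp only [node, measurableAtom, Set.mem_iInter]
    intro s hs hm
    rw [hℱ, MeasurableSpace.measurableSet_bot_iff] at hm
    rcases hm with rfl | rfl
    · exact hs.elim
    · trivial
  have hπ' : π 0 ω' = π 0 ω := by
    ext j k
    exact eq_of_mem_measurableAtom (hπmeas 0 (Nat.zero_le T) j k) h
  rw [SHP_eq (Nat.zero_le T), SHP_eq (Nat.zero_le T), continuationSet_congr (Nat.zero_le T) hX h,
    hπ']

end SelfFinancing

end Superhedging

/-! ### The main theorem -/

open Superhedging in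
theorem mainTheorem2 {Ω : Type*} [Finite Ω] {m : MeasurableSpace Ω}
    (P : Measure Ω) [IsProbabilityMeasure P] (hP : ∀ ω, 0 < P {ω})
    (T : ℕ) (ℱ : Filtration ℕ m) (hℱ : ℱ 0 = ⊥)
    (d : ℕ) (π : ℕ → Ω → Matrix (Fin d) (Fin d) ℝ)
    (hπmeas : ∀ t ≤ T, ∀ j k, Measurable[ℱ t] fun ω => π t ω j k)
    (hπ : ∀ t ≤ T, ∀ ω, IsBidAsk (π t ω))
    (hNA : NoArbitrage P ℱ T π)
    (X : Ω → Fin d → ℝ) (hX : Measurable[ℱ T] X) (i : Fin d) :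
    -- at time `0` the recursion gives the set of superhedging initial portfolios
    (∀ ω, initialSuperhedging P ℱ T π X = SHP ℱ T π X 0 ω) ∧
    ∀ t ≤ T, ∀ ω,
      -- the vertices of the hypograph give the superhedging portfolios
      SHP ℱ T π X t ω =
        {x | ∀ (S : Fin d → ℝ) (v : ℝ), scalarV ℱ T π X i t ω S = (v : EReal) →
          (S, v) ∈ (hypo (scalarV ℱ T π X i t ω)).extremePoints ℝ → v ≤ S ⬝ᵥ x} ∧
      -- the superhedging portfolios are the upper image of a linear vector optimization problem
      (∃ (r : ℕ) (B : Matrix (Fin r) (Fin d) ℝ) (b : Fin r → ℝ),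
        feasible B b = (if t < T then ⋂ ω' ∈ node ℱ t ω, SHP ℱ T π X (t + 1) ω'
          else SHP ℱ T π X t ω) ∧
        upperImage 1 B b (solvencyCone (π t ω)) = SHP ℱ T π X t ω) ∧
      -- the hypograph is the lower image of the geometric dual of every such problem
      (∀ (r : ℕ) (B : Matrix (Fin r) (Fin d) ℝ) (b : Fin r → ℝ),
        upperImage 1 B b (solvencyCone (π t ω)) = SHP ℱ T π X t ω →
        omitCoord i '' hypo (scalarV ℱ T π X i t ω) =
          lowerImage 1 B b (solvencyCone (π t ω)) (Pi.single i 1) i) := by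
  refine ⟨fun ω => ?_, fun t ht ω => ⟨?_, ?_, ?_⟩⟩
  · ext x₀
    rw [mem_initialSuperhedging_iff hP hπmeas hX]
    exact ⟨fun h => h ω, fun h ω' => by rwa [SHP_zero_congr hℱ hπmeas hX ω ω']⟩
  · have hsolv : IsSolvent (π t ω) (SHP ℱ T π X t ω) := isSolvent_SHP ht ω
    ext x
    rw [hsolv.mem_iff (i := i) (hπ t ht ω), ← hypo_scalarV hπ ht ω, Set.mem_ofPred_eq]
    refine ⟨fun h S v _ hSv => h _ hSv.1, fun h => ?_⟩
    rw [hypo_scalarV hπ ht ω] at h ⊢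
    refine le_dotProduct_of_forall_extremePoints (hπ t ht ω) hsolv.nonempty fun p hp => ?_
    rw [← hypo_scalarV hπ ht ω] at h hp
    -- A vertex lies on the graph, so the condition that `v` is the function value holds
    -- automatically.
    exact h p.1 p.2 (eq_of_mem_extremePoints_hypo hp) hp
  · have himg : ∀ (r : ℕ) (B : Matrix (Fin r) (Fin d) ℝ) (b : Fin r → ℝ),
        upperImage 1 B b (solvencyCone (π t ω)) = feasible B b + solvencyCone (π t ω) :=
      fun r B b => by simp [upperImage]
    split_ifs with h
    · obtain ⟨r, B, b, hB⟩ :=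
        (isPolyhedral_continuationSet (ℱ := ℱ) (π := π) (X := X) ht ω).1.exists_feasible
      exact ⟨r, B, b, by rw [hB, continuationSet_of_lt h], by rw [himg, hB, SHP_eq ht]⟩
    · obtain ⟨r, B, b, hB⟩ :=
        (isPolyhedral_SHP (ℱ := ℱ) (π := π) (X := X) ht ω).exists_feasible
      refine ⟨r, B, b, hB, ?_⟩
      rw [himg, hB]
      -- At `t = T` the feasible set already contains the summand `K_T`, and adding the cone again
      -- changes nothing.
      refine Set.Subset.antisymm ?_ fun x hx => ⟨x, hx, 0, zero_mem_solvencyCone, add_zero x⟩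
      rintro _ ⟨x, hx, k, hk, rfl⟩
      exact (isSolvent_SHP ht ω).add_mem x hx k hk
  · intro r B b hB
    have hsolv : IsSolvent (π t ω) (SHP ℱ T π X t ω) := isSolvent_SHP ht ω
    rw [hypo_scalarV hπ ht ω, ← hB]
    exact omitCoord_image_supportHypo (hπ t ht ω) (hB ▸ hsolv.nonempty)
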